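/- Let $\mathbb F$ be a finite field, $f\in\mathbb F[x]$ a monic polynomial and $A=\mathbb F[x]/\langle f\rangle$. An $A$-code of length $l$ is an $A$-submodule $C$ of $A^l$; its dual is $C^\perp=\{a\in A^l : \sum_{i=1}^l a_ic_i=0 \text{ for all } c\in C\}$, and $C$ is self-dual if $C=C^\perp$. If $l$ is a multiple of $4$, then there exists a self-dual $A$-code of length $l$. Also, there exist self-dual $A$-codes of all lengths if and only if $f$ is a square in $\mathbb F[x]$. Moreover, let $f=f_1^{e_1}\cdots f_t^{e_t}$ be the prime decomposition of $f$ in $\mathbb F[x]$ (the $f_i$ irreducible and pairwise non-associate, all $e_i\ge 1$) and $d_i=\deg f_i$. Then the following are equivalent: 1. There exist self-dual $A$-codes of all even lengths. 2. $f=g^2f'$ for some $g,f'\in\mathbb F[x]$ such that $-1$ is a square modulo $f'$ (that is, a square in $\mathbb F[x]/\langle f'\rangle$). 3. Either $|\mathbb F|\equiv 3\pmod 4$ and $d_ie_i$ is even for each $1\le i\le t$, or $|\mathbb F|$ is even, or $|\mathbb F|\equiv 1\pmod 4$. -/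

import Mathlib

open Polynomial

/-- The quotient ring `A = F[x]/(f)`. -/
abbrev QuotRing {F : Type*} [Field F] (f : F[X]) : Type _ := F[X] ⧸ Ideal.span {f}

/-- An `A`-code of length `l`, i.e. an `A`-submodule of `A^l`, where `A = F[x]/(f)`. -/
abbrev ACode {F : Type*} [Field F] (f : F[X]) (l : ℕ) : Type _ :=
  Submodule (QuotRing f) (Fin l → QuotRing f)

/-- The dual code `C^⊥ = {a ∈ A^l | ∀ c ∈ C, ∑ i, a_i c_i = 0}`. -/
def ACode.dual {F : Type*} [Field F] {f : F[X]} {l : ℕ} (C : ACode f l) : ACode f l where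
  carrier := {a | ∀ c ∈ C, ∑ i, a i * c i = 0}
  zero_mem' := by
    intro c _
    simp
  add_mem' := by
    intro a b ha hb c hc
    simp only [Pi.add_apply, add_mul, Finset.sum_add_distrib]
    rw [ha c hc, hb c hc, add_zero]
  smul_mem' := by
    intro r a ha c hc
    simp only [Pi.smul_apply, smul_eq_mul, mul_assoc]
    rw [← Finset.mul_sum, ha c hc, mul_zero]

/-- `C` is self-dual when `C = C^⊥`. -/
def ACode.IsSelfDual {F : Type*} [Field F] {f : F[X]} {l : ℕ} (C : ACode f l) : Prop :=
  C = ACode.dual C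

/-- There exists a self-dual `A`-code of length `l`, where `A = F[x]/(f)`. -/
def ExistsSelfDualCode {F : Type*} [Field F] (f : F[X]) (l : ℕ) : Prop :=
  ∃ C : ACode f l, ACode.IsSelfDual C

/-- `f = p_1^{e_1} ⋯ p_t^{e_t}` is the prime decomposition of `f` in `F[x]`: the `p_i` are
irreducible, pairwise non-associate, and the exponents are positive. -/
def IsPrimeDecomposition {F : Type*} [Field F] (f : F[X]) {t : ℕ}
    (p : Fin t → F[X]) (e : Fin t → ℕ) : Prop :=
  (∀ i, Irreducible (p i)) ∧ (∀ i j, i ≠ j → ¬ Associated (p i) (p j)) ∧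
    (∀ i, 0 < e i) ∧ f = ∏ i, p i ^ e i

/-! Self-dual codes are built in lengths 1, 2 and 4 and repeated orthogonally. For `f = g ^ 2` take
the ideal `(g)`. For `f = g ^ 2 * f'` with `f' ∣ h ^ 2 + 1`, take `g` times the span of `(1, h)` and
`(0, f')`. In length 4, use a solution of `a ^ 2 + b ^ 2 = -1` in the finite field. Conversely, a
self-dual code of length 1 is an ideal equal to its own annihilator, which makes `f` a square. In
length 2 the obstruction is a prime `p` of odd multiplicity modulo which `-1` is not a square: `a ^
2 + b ^ 2` is then anisotropic mod `p`, so all codewords are too divisible by `p` for the code to be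
its own dual. Since `F[x]/(p)` is a finite field, the criterion depends only on `|F| ^ deg p` mod 4.
-/

theorem ACode.isSelfDual_iff {F : Type*} [Field F] {f : F[X]} {l : ℕ} (C : ACode f l) :
    C.IsSelfDual ↔ ∀ a, a ∈ C ↔ ∀ c ∈ C, ∑ i, a i * c i = 0 :=
  SetLike.ext_iff

/-! ### Constructions in lengths 1, 2 and 4 -/

/-- A self-dual code can be repeated `k` times as an orthogonal direct sum. -/
theorem ExistsSelfDualCode.mul {F : Type*} [Field F] {f : F[X]} {n : ℕ}
    (h : ExistsSelfDualCode f n) (k : ℕ) : ExistsSelfDualCode f (n * k) := by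
  obtain ⟨C, hC⟩ := h
  rw [ACode.isSelfDual_iff] at hC
  let D : ACode f (n * k) :=
    ⨅ j : Fin k, C.comap (LinearMap.funLeft _ _ fun i : Fin n => finProdFinEquiv (i, j))
  have hD : ∀ a, a ∈ D ↔ ∀ j, (fun i => a (finProdFinEquiv (i, j))) ∈ C := fun a => by
    simp only [D, Submodule.mem_iInf, Submodule.mem_comap]
    rfl
  have hsum : ∀ a c : Fin (n * k) → QuotRing f, ∑ x, a x * c x =
      ∑ j, ∑ i, a (finProdFinEquiv (i, j)) * c (finProdFinEquiv (i, j)) := fun a c => by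
    rw [← Equiv.sum_comp finProdFinEquiv, Fintype.sum_prod_type_right]
  refine ⟨D, (ACode.isSelfDual_iff D).2 fun a => ⟨fun ha c hc => ?_, fun ha => ?_⟩⟩
  · rw [hsum]
    exact Finset.sum_eq_zero fun j _ => (hC _).1 ((hD a).1 ha j) _ ((hD c).1 hc j)
  · refine (hD a).2 fun j => (hC _).2 fun c hc => ?_
    -- Placing `c` in block `j` and zero elsewhere isolates block `j` of `a`.
    let c' : Fin (n * k) → QuotRing f := fun x =>
      if (finProdFinEquiv.symm x).2 = j then c (finProdFinEquiv.symm x).1 else 0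
    have hc' : ∀ i j', c' (finProdFinEquiv (i, j')) = if j' = j then c i else 0 := fun i j' => by
      simp only [c', Equiv.symm_apply_apply]
    have hmem : c' ∈ D := (hD c').2 fun j' => by
      simp only [hc']
      split_ifs
      · exact hc
      · exact C.zero_mem
    have := ha c' hmem
    rw [hsum, Finset.sum_eq_single j] at this
    · simpa only [hc', if_true] using this
    · intro j' _ hne
      simp only [hc', if_neg hne, mul_zero, Finset.sum_const_zero]
    · simp

theorem existsSelfDualCode_four {F : Type*} [Field F] (f : F[X]) {a b : F}
    (hab : a ^ 2 + b ^ 2 = -1) : ExistsSelfDualCode f 4 := by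
  obtain ⟨α, β, h⟩ : ∃ α β : QuotRing f, α ^ 2 + β ^ 2 = -1 := by
    refine ⟨Ideal.Quotient.mk _ (C a), Ideal.Quotient.mk _ (C b), ?_⟩
    simp only [← map_pow, ← map_add, hab, map_neg, map_one]
  -- The graph of `M = [[α, -β], [β, α]]`, for which `Mᵀ M = -1`.
  let D : ACode f 4 :=
    { carrier := {x | x 2 = α * x 0 - β * x 1 ∧ x 3 = β * x 0 + α * x 1}
      zero_mem' := by simp
      add_mem' := by
        rintro x y ⟨h1, h2⟩ ⟨h3, h4⟩
        simp only [Set.mem_ofPred_eq, Pi.add_apply, h1, h2, h3, h4]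
        constructor <;> ring
      smul_mem' := by
        rintro r x ⟨h1, h2⟩
        simp only [Set.mem_ofPred_eq, Pi.smul_apply, smul_eq_mul, h1, h2]
        constructor <;> ring }
  have hD : ∀ x, x ∈ D ↔ x 2 = α * x 0 - β * x 1 ∧ x 3 = β * x 0 + α * x 1 := fun _ => Iff.rfl
  refine ⟨D, (ACode.isSelfDual_iff D).2 fun x => ⟨fun hx y hy => ?_, fun hx => ?_⟩⟩
  · obtain ⟨h1, h2⟩ := (hD x).1 hx
    obtain ⟨h3, h4⟩ := (hD y).1 hy
    rw [Fin.sum_univ_four, h1, h2, h3, h4]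
    linear_combination (x 0 * y 0 + x 1 * y 1) * h
  · have h1 := hx ![1, 0, α, β] ((hD _).2 (by simp))
    have h2 := hx ![0, 1, -β, α] ((hD _).2 (by simp))
    simp [Fin.sum_univ_four] at h1 h2
    refine (hD x).2 ⟨?_, ?_⟩
    · linear_combination x 2 * h - α * h1 + β * h2
    · linear_combination x 3 * h - β * h1 - α * h2

theorem existsSelfDualCode_one {F : Type*} [Field F] {g : F[X]} (hg : g ≠ 0) :
    ExistsSelfDualCode (g ^ 2) 1 := by
  let D : ACode (g ^ 2) 1 := Submodule.comap
    (LinearMap.proj (R := QuotRing (g ^ 2)) (φ := fun _ : Fin 1 => QuotRing (g ^ 2)) 0)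
    (Ideal.span {Ideal.Quotient.mk (Ideal.span {g ^ 2}) g} : Ideal (QuotRing (g ^ 2)))
  have hD : ∀ x, x ∈ D ↔ ∃ u, x 0 = Ideal.Quotient.mk _ g * u := fun x =>
    Ideal.mem_span_singleton (x := x 0)
  have hzero : (Ideal.Quotient.mk (Ideal.span {g ^ 2}) g) ^ 2 = 0 := by
    rw [← map_pow, Ideal.Quotient.eq_zero_iff_dvd]
  refine ⟨D, (ACode.isSelfDual_iff D).2 fun x => ⟨fun hx y hy => ?_, fun hx => ?_⟩⟩
  · obtain ⟨u, hu⟩ := (hD x).1 hx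
    obtain ⟨v, hv⟩ := (hD y).1 hy
    rw [Fin.sum_univ_one, hu, hv]
    linear_combination u * v * hzero
  · have h1 := hx (fun _ => Ideal.Quotient.mk _ g) ((hD _).2 ⟨1, by simp⟩)
    obtain ⟨a, ha⟩ := Ideal.Quotient.mk_surjective (x 0)
    rw [Fin.sum_univ_one, ← ha, ← map_mul, Ideal.Quotient.eq_zero_iff_dvd, pow_two,
      mul_dvd_mul_iff_right hg] at h1
    obtain ⟨k, rfl⟩ := h1
    exact (hD x).2 ⟨Ideal.Quotient.mk _ k, by rw [← ha, map_mul]⟩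

theorem existsSelfDualCode_two {F : Type*} [Field F] {g f' h : F[X]} (hg : g ≠ 0) (hf' : f' ≠ 0)
    (hh : f' ∣ h ^ 2 + 1) : ExistsSelfDualCode (g ^ 2 * f') 2 := by
  let π := Ideal.Quotient.mk (Ideal.span {g ^ 2 * f'})
  let D : ACode (g ^ 2 * f') 2 :=
    { carrier := {x | ∃ u w, x 0 = π g * u ∧ x 1 = π g * (π h * u + π f' * w)}
      zero_mem' := ⟨0, 0, by simp⟩
      add_mem' := by
        rintro x y ⟨u, w, h1, h2⟩ ⟨u', w', h3, h4⟩
        refine ⟨u + u', w + w', ?_, ?_⟩ <;> simp only [Pi.add_apply, h1, h2, h3, h4] <;> ring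
      smul_mem' := by
        rintro r x ⟨u, w, h1, h2⟩
        refine ⟨r * u, r * w, ?_, ?_⟩ <;> simp only [Pi.smul_apply, smul_eq_mul, h1, h2] <;> ring }
  have hD : ∀ x, x ∈ D ↔ ∃ u w, x 0 = π g * u ∧ x 1 = π g * (π h * u + π f' * w) :=
    fun _ => Iff.rfl
  obtain ⟨s, hs⟩ := hh
  have hzero : π g ^ 2 * π f' = 0 := by
    rw [← map_pow, ← map_mul]
    exact Ideal.Quotient.eq_zero_iff_dvd _ _ |>.2 dvd_rfl
  have hs' : π h ^ 2 + 1 = π f' * π s := by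
    rw [← map_mul, ← hs, map_add, map_pow, map_one]
  refine ⟨D, (ACode.isSelfDual_iff D).2 fun x => ⟨fun hx y hy => ?_, fun hx => ?_⟩⟩
  · obtain ⟨u, w, h1, h2⟩ := (hD x).1 hx
    obtain ⟨u', w', h3, h4⟩ := (hD y).1 hy
    rw [Fin.sum_univ_two, h1, h2, h3, h4]
    linear_combination π g ^ 2 * u * u' * hs' +
      (u * u' * π s + π h * u * w' + w * π h * u' + π f' * w * w') * hzero
  · have h1 := hx ![π g, π g * π h] ((hD _).2 ⟨1, 0, by simp⟩)
    have h2 := hx ![0, π g * π f'] ((hD _).2 ⟨0, 1, by simp⟩)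
    obtain ⟨a, ha⟩ := Ideal.Quotient.mk_surjective (x 0)
    obtain ⟨b, hb⟩ := Ideal.Quotient.mk_surjective (x 1)
    change π a = x 0 at ha
    change π b = x 1 at hb
    simp only [Fin.sum_univ_two, Matrix.cons_val_zero, Matrix.cons_val_one, ← ha, ← hb, mul_zero,
      zero_add, ← map_mul, ← map_add] at h1 h2
    obtain ⟨r, hr⟩ := (Ideal.Quotient.eq_zero_iff_dvd _ _).1 h1
    obtain ⟨t, ht⟩ := (Ideal.Quotient.eq_zero_iff_dvd _ _).1 h2
    have hbt : b = g * t := mul_right_cancel₀ (mul_ne_zero hg hf') (by linear_combination ht)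
    have hau : a = g * (f' * r - t * h) :=
      mul_right_cancel₀ hg (by linear_combination hr - g * h * hbt)
    -- With `u = f' * r - t * h`, the second witness solves `t = h * u + f' * w`, using `h ^ 2 + 1 =
    -- f' * s`.
    refine (hD x).2 ⟨π (f' * r - t * h), π (s * t - h * r), ?_, ?_⟩
    · rw [← ha, hau, map_mul]
    · simp only [← hb, ← map_mul, ← map_add]
      congr 1
      linear_combination hbt + g * t * hs

/-! ### Obstruction in length 1 -/

theorem exists_eq_sq_of_existsSelfDualCode_one {F : Type*} [Field F] {f : F[X]} (hf : f.Monic)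
    (h : ExistsSelfDualCode f 1) : ∃ g : F[X], f = g ^ 2 := by
  classical
  obtain ⟨D, hD⟩ := h
  rw [ACode.isSelfDual_iff] at hD
  let π := Ideal.Quotient.mk (Ideal.span {f})
  have hπ : ∀ a, π a = 0 ↔ f ∣ a := fun a => Ideal.Quotient.eq_zero_iff_dvd _ _
  have hD' : ∀ a : F[X], (fun _ => π a) ∈ D ↔ ∀ b, (fun _ => π b) ∈ D → f ∣ a * b := fun a => by
    rw [hD]
    simp only [Fin.sum_univ_one]
    refine ⟨fun H b hb => by simpa only [← map_mul, hπ] using H _ hb, fun H c hc => ?_⟩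
    obtain ⟨b, hb⟩ := Ideal.Quotient.mk_surjective (c 0)
    have hcb : c = fun _ => π b := funext fun i => by rw [Subsingleton.elim i 0, ← hb]
    rw [hcb] at hc ⊢
    exact (map_mul π a b) ▸ (hπ _).2 (H b hc)
  let I : Ideal F[X] :=
    { carrier := {a | (fun _ => π a) ∈ D}
      zero_mem' := by
        change (fun _ => π 0) ∈ D
        rw [map_zero]
        exact D.zero_mem
      add_mem' := fun {a b} ha hb => by
        change (fun _ => π (a + b)) ∈ D
        rw [map_add]
        exact D.add_mem ha hb
      smul_mem' := fun r a ha => by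
        change (fun _ => π (r * a)) ∈ D
        rw [map_mul]
        exact D.smul_mem (π r) ha }
  have hI : ∀ a, a ∈ I ↔ ∀ b ∈ I, f ∣ a * b := hD'
  obtain ⟨g, hg⟩ := IsPrincipalIdealRing.principal I
  have hgI : ∀ a, a ∈ I ↔ g ∣ a := fun a => by
    rw [hg]; exact Ideal.mem_span_singleton
  have hgg : f ∣ g * g := (hI g).1 ((hgI g).2 dvd_rfl) g ((hgI g).2 dvd_rfl)
  obtain ⟨k, hk⟩ : g ∣ f := (hgI f).1 ((hI f).2 fun b _ => dvd_mul_right f b)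
  have hg0 : g ≠ 0 := fun h0 => hf.ne_zero (by rw [hk, h0, zero_mul])
  -- The cofactor `k = f / g` multiplies `I = (g)` into `(f)`, so it lies in `I`; hence `g * g ∣ f`.
  have hgk : g ∣ k := (hgI k).1 ((hI k).2 fun b hb => by
    obtain ⟨c, rfl⟩ := (hgI b).1 hb
    exact ⟨c, by rw [hk]; ring⟩)
  have hggf : g * g ∣ f := hk ▸ mul_dvd_mul_left g hgk
  refine ⟨normalize g, ?_⟩
  rw [← hf.normalize_eq_self, pow_two, ← normalize_mul]
  exact normalize_eq_normalize hgg hggf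

/-! ### Square roots of -1 modulo polynomials -/

theorem isSquare_neg_one_quotient_iff {R : Type*} [CommRing R] (n : R) :
    IsSquare (-1 : R ⧸ Ideal.span {n}) ↔ ∃ h, n ∣ h ^ 2 + 1 := by
  constructor
  · rintro ⟨r, hr⟩
    obtain ⟨h, rfl⟩ := Ideal.Quotient.mk_surjective r
    refine ⟨h, (Ideal.Quotient.eq_zero_iff_dvd _ _).1 ?_⟩
    rw [map_add, map_pow, map_one]
    linear_combination -hr
  · rintro ⟨h, hh⟩
    refine ⟨Ideal.Quotient.mk _ h, ?_⟩
    have := (Ideal.Quotient.eq_zero_iff_dvd _ _).2 hh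
    rw [map_add, map_pow, map_one] at this
    linear_combination -this

theorem exists_prod_dvd_sq_add_one {R ι : Type*} [CommRing R] (p : ι → R) (s : Finset ι)
    (hp : ∀ i ∈ s, ∃ h, p i ∣ h ^ 2 + 1) (hco : ∀ i ∈ s, ∀ j ∈ s, i ≠ j → IsCoprime (p i) (p j)) :
    ∃ h, ∏ i ∈ s, p i ∣ h ^ 2 + 1 := by
  classical
  induction s using Finset.induction_on with
  | empty => simp
  | insert i s hi ih =>
    obtain ⟨h, hh⟩ := ih (fun j hj => hp j (Finset.mem_insert_of_mem hj)) fun j hj k hk =>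
      hco j (Finset.mem_insert_of_mem hj) k (Finset.mem_insert_of_mem hk)
    obtain ⟨h', hh'⟩ := hp i (Finset.mem_insert_self i s)
    have hc : IsCoprime (p i) (∏ j ∈ s, p j) := IsCoprime.prod_right fun j hj =>
      hco i (Finset.mem_insert_self i s) j (Finset.mem_insert_of_mem hj) fun hij => hi (hij ▸ hj)
    rw [Finset.prod_insert hi]
    obtain ⟨a, b, hab⟩ := hc
    set P := ∏ j ∈ s, p j
    -- Chinese remainders: this is `h'` mod `p i` and `h` mod `P`.
    refine ⟨a * p i * h + b * P * h', IsCoprime.mul_dvd ⟨a, b, hab⟩ ?_ ?_⟩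
    · obtain ⟨c, hc⟩ := hh'
      refine ⟨c + a * (h - h') * (2 * h' + a * p i * (h - h')), ?_⟩
      have : b * P = 1 - a * p i := by linear_combination hab
      rw [this]
      linear_combination hc
    · obtain ⟨c, hc⟩ := hh
      refine ⟨c + b * (h' - h) * (2 * h + b * P * (h' - h)), ?_⟩
      have : a * p i = 1 - b * P := by linear_combination hab
      rw [this]
      linear_combination hc

theorem isSquare_neg_one_quotient_irreducible_iff {F : Type*} [Field F] [Finite F] {p : F[X]}
    (hp : Irreducible p) :
    IsSquare (-1 : F[X] ⧸ Ideal.span {p}) ↔ Nat.card F ^ p.natDegree % 4 ≠ 3 := by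
  have : Fact (Irreducible p) := ⟨hp⟩
  let pb := AdjoinRoot.powerBasis hp.ne_zero
  have : Module.Finite F (AdjoinRoot p) := pb.finite
  have : Finite (AdjoinRoot p) := Module.finite_of_finite F
  have := Fintype.ofFinite (AdjoinRoot p)
  have hcard : Fintype.card (AdjoinRoot p) = Nat.card F ^ p.natDegree := by
    rw [← Nat.card_eq_fintype_card, Module.natCard_eq_pow_finrank (K := F), pb.finrank,
      AdjoinRoot.powerBasis_dim]
  rw [← hcard]
  exact FiniteField.isSquare_neg_one_iff (F := AdjoinRoot p)

/-! ### Obstruction in length 2 -/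

/-- Otherwise `b` has an inverse `v` mod `p`, and `v * a` is a square root of `-1`. -/
theorem Irreducible.dvd_right_of_dvd_sq_add_sq {F : Type*} [Field F] {p : F[X]} (hp : Irreducible p)
    (hsq : ¬ ∃ h, p ∣ h ^ 2 + 1) {a b : F[X]} (hab : p ∣ a ^ 2 + b ^ 2) : p ∣ b := by
  by_contra hb
  obtain ⟨u, v, huv⟩ := (hp.coprime_iff_not_dvd.2 hb)
  obtain ⟨c, hc⟩ := hab
  refine hsq ⟨v * a, v ^ 2 * c + u * (2 - u * p), ?_⟩
  have : v * b = 1 - u * p := by linear_combination huv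
  linear_combination v ^ 2 * hc - (v * b + 1 - u * p) * this

/-- Descent: `p` divides both entries, so `p ^ 2` cancels. The odd exponent gains the extra factor:
`m + 1` rather than `m`. -/
theorem pow_dvd_of_pow_dvd_sq_add_sq {F : Type*} [Field F] {p : F[X]} (hp : Irreducible p)
    (hsq : ¬ ∃ h, p ∣ h ^ 2 + 1) (m : ℕ) {a b : F[X]} (hab : p ^ (2 * m + 1) ∣ a ^ 2 + b ^ 2) :
    p ^ (m + 1) ∣ a ∧ p ^ (m + 1) ∣ b := by
  induction m generalizing a b with
  | zero =>
    simp only [mul_zero, zero_add, pow_one] at hab ⊢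
    exact ⟨hp.dvd_right_of_dvd_sq_add_sq hsq (add_comm (a ^ 2) _ ▸ hab),
      hp.dvd_right_of_dvd_sq_add_sq hsq hab⟩
  | succ m ih =>
    have h1 : p ∣ a ^ 2 + b ^ 2 := (dvd_pow_self p (by omega)).trans hab
    obtain ⟨a, rfl⟩ := hp.dvd_right_of_dvd_sq_add_sq hsq (add_comm (a ^ 2) _ ▸ h1)
    obtain ⟨b, rfl⟩ := hp.dvd_right_of_dvd_sq_add_sq hsq h1
    have h2 : p ^ 2 * p ^ (2 * m + 1) ∣ p ^ 2 * (a ^ 2 + b ^ 2) := by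
      convert hab using 1 <;> ring
    rw [mul_dvd_mul_iff_left (pow_ne_zero 2 hp.ne_zero)] at h2
    rw [pow_succ' p (m + 1)]
    exact ⟨mul_dvd_mul_left p (ih h2).1, mul_dvd_mul_left p (ih h2).2⟩

theorem not_existsSelfDualCode_two {F : Type*} [Field F] {p k : F[X]} (hp : Irreducible p)
    (hpk : ¬ p ∣ k) (hsq : ¬ ∃ h, p ∣ h ^ 2 + 1) (m : ℕ) :
    ¬ ExistsSelfDualCode (p ^ (2 * m + 1) * k) 2 := by
  rintro ⟨D, hD⟩
  rw [ACode.isSelfDual_iff] at hD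
  let π := Ideal.Quotient.mk (Ideal.span {p ^ (2 * m + 1) * k})
  have hπ : ∀ a, π a = 0 ↔ p ^ (2 * m + 1) * k ∣ a := fun a => Ideal.Quotient.eq_zero_iff_dvd _ _
  have hdiv : ∀ a b : F[X], ![π a, π b] ∈ D → p ^ (m + 1) ∣ a := fun a b hab => by
    have h0 := (hD _).1 hab _ hab
    simp only [Fin.sum_univ_two, Matrix.cons_val_zero, Matrix.cons_val_one, ← pow_two] at h0
    rw [← map_pow, ← map_pow, ← map_add, hπ] at h0
    exact (pow_dvd_of_pow_dvd_sq_add_sq hp hsq m ((dvd_mul_right _ _).trans h0)).1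
  -- First coordinates in `D` are multiples of `p ^ (m + 1)`, so this vector is orthogonal to `D`;
  -- but its own first coordinate has only `m` factors of `p`.
  have hmem : ![π (p ^ m * k), π 0] ∈ D := (hD _).2 fun c hc => by
    obtain ⟨a, ha⟩ := Ideal.Quotient.mk_surjective (c 0)
    obtain ⟨b, hb⟩ := Ideal.Quotient.mk_surjective (c 1)
    have hcab : c = ![π a, π b] := by
      ext i
      fin_cases i
      · exact ha.symm
      · exact hb.symm
    rw [hcab] at hc ⊢
    obtain ⟨r, rfl⟩ := hdiv a b hc
    simp only [Fin.sum_univ_two, Matrix.cons_val_zero, Matrix.cons_val_one, ← map_mul, ← map_add,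
      hπ]
    exact ⟨r, by ring⟩
  have := hdiv _ _ hmem
  rw [pow_succ, mul_dvd_mul_iff_left (pow_ne_zero m hp.ne_zero)] at this
  exact hpk this

theorem Odd.pow_mod_four_eq_three {q d : ℕ} (hq : q % 4 = 3) (hd : Odd d) : q ^ d % 4 = 3 := by
  obtain ⟨n, rfl⟩ := hd
  rw [pow_succ, pow_mul, Nat.mul_mod, Nat.pow_mod, Nat.pow_mod q 2, hq]
  simp

theorem Even.pow_mod_four_eq_one {q d : ℕ} (hq : q % 4 = 3) (hd : Even d) : q ^ d % 4 = 1 := by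
  obtain ⟨n, rfl⟩ := hd
  rw [← two_mul, pow_mul, Nat.pow_mod, Nat.pow_mod q 2, hq]
  simp

theorem FiniteField.exists_sq_add_sq_eq_neg_one (F : Type*) [Field F] [Finite F] :
    ∃ a b : F, a ^ 2 + b ^ 2 = -1 := by
  have := Fintype.ofFinite F
  obtain ⟨p, hp⟩ := CharP.exists F
  have : NeZero p := ⟨CharP.char_ne_zero_of_finite F p⟩
  obtain ⟨a, b, hab⟩ := CharP.sq_add_sq F p (-1)
  exact ⟨a, b, by simpa using hab⟩

theorem IsPrimeDecomposition.even_of_existsSelfDualCode_two {F : Type*} [Field F] [Finite F]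
    {f : F[X]} {t : ℕ} {p : Fin t → F[X]} {e : Fin t → ℕ} (h : IsPrimeDecomposition f p e)
    (hq : Nat.card F % 4 = 3) (hC : ExistsSelfDualCode f 2) (i : Fin t) :
    Even ((p i).natDegree * e i) := by
  obtain ⟨hirr, hass, -, rfl⟩ := h
  by_contra hodd
  rw [Nat.not_even_iff_odd, Nat.odd_mul] at hodd
  obtain ⟨hd, m, hm⟩ := hodd
  have hsq : ¬ ∃ h, p i ∣ h ^ 2 + 1 := by
    rw [← isSquare_neg_one_quotient_iff, isSquare_neg_one_quotient_irreducible_iff (hirr i),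
      hd.pow_mod_four_eq_three hq]
    simp
  rw [← Finset.mul_prod_erase _ _ (Finset.mem_univ i), hm] at hC
  refine not_existsSelfDualCode_two (hirr i) (fun hdvd => ?_) hsq m hC
  obtain ⟨j, hj, hij⟩ := ((hirr i).prime.dvd_finsetProd_iff _).1 hdvd
  exact hass i j (Finset.ne_of_mem_erase hj).symm
    ((hirr i).associated_of_dvd (hirr j) ((hirr i).prime.dvd_of_dvd_pow hij))

theorem IsPrimeDecomposition.exists_eq_sq_mul {F : Type*} [Field F] [Finite F]
    {f : F[X]} {t : ℕ} {p : Fin t → F[X]} {e : Fin t → ℕ} (h : IsPrimeDecomposition f p e)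
    (hq : Nat.card F % 4 = 3) (hev : ∀ i, Even ((p i).natDegree * e i)) :
    ∃ g f' : F[X], f = g ^ 2 * f' ∧ ∃ h, f' ∣ h ^ 2 + 1 := by
  obtain ⟨hirr, hass, -, rfl⟩ := h
  -- `f'` keeps one copy of each prime of odd exponent; those primes have even degree.
  refine ⟨∏ i, p i ^ (e i / 2), ∏ i with Odd (e i), p i, ?_, ?_⟩
  · rw [← Finset.prod_pow, Finset.prod_filter, ← Finset.prod_mul_distrib]
    refine Finset.prod_congr rfl fun i _ => ?_
    split_ifs with ho
    · rw [← pow_mul, ← pow_succ, mul_comm, Nat.two_mul_div_two_add_one_of_odd ho]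
    · rw [← pow_mul, mul_one, Nat.div_mul_cancel (Nat.not_odd_iff_even.1 ho).two_dvd]
  · refine exists_prod_dvd_sq_add_one p _ (fun i hi => ?_) fun i _ j _ hij => ?_
    · have ho : Odd (e i) := (Finset.mem_filter.1 hi).2
      have hd : Even (p i).natDegree := (Nat.even_mul.1 (hev i)).resolve_right
        (Nat.not_even_iff_odd.2 ho)
      rw [← isSquare_neg_one_quotient_iff, isSquare_neg_one_quotient_irreducible_iff (hirr i),
        hd.pow_mod_four_eq_one hq]
      simp
    · exact (hirr i).coprime_iff_not_dvd.2 fun hdvd =>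
        hass i j hij ((hirr i).associated_of_dvd (hirr j) hdvd)

theorem theorem3p9 {F : Type*} [Field F] [Finite F] (f : F[X]) (hf : f.Monic) :
    (∀ l : ℕ, 4 ∣ l → ExistsSelfDualCode f l) ∧
    ((∀ l : ℕ, ExistsSelfDualCode f l) ↔ ∃ g : F[X], f = g ^ 2) ∧
    (∀ (t : ℕ) (p : Fin t → F[X]) (e : Fin t → ℕ), IsPrimeDecomposition f p e →
      List.TFAE [
        ∀ l : ℕ, Even l → ExistsSelfDualCode f l,
        ∃ g f' : F[X], f = g ^ 2 * f' ∧
          IsSquare (-1 : F[X] ⧸ Ideal.span {f'}),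
        (Nat.card F % 4 = 3 ∧ ∀ i, Even ((p i).natDegree * e i)) ∨
          Even (Nat.card F) ∨ Nat.card F % 4 = 1]) := by
  refine ⟨?_, ⟨fun h => exists_eq_sq_of_existsSelfDualCode_one hf (h 1), ?_⟩, ?_⟩
  · rintro _ ⟨k, rfl⟩
    obtain ⟨a, b, hab⟩ := FiniteField.exists_sq_add_sq_eq_neg_one F
    exact (existsSelfDualCode_four f hab).mul k
  · rintro ⟨g, rfl⟩ l
    have hg : g ≠ 0 := fun h0 => hf.ne_zero (by simp [h0])
    simpa using (existsSelfDualCode_one hg).mul l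
  · intro t p e hpe
    simp only [isSquare_neg_one_quotient_iff]
    tfae_have 1 → 3 := fun h => by
      by_cases hq : Nat.card F % 4 = 3
      · exact Or.inl ⟨hq, hpe.even_of_existsSelfDualCode_two hq (h 2 even_two)⟩
      · rw [Nat.even_iff]
        omega
    tfae_have 3 → 2 := by
      rintro (⟨hq, hev⟩ | hq)
      · exact hpe.exists_eq_sq_mul hq hev
      · have := Fintype.ofFinite F
        obtain ⟨r, hr⟩ : IsSquare (-1 : F) := by
          rw [FiniteField.isSquare_neg_one_iff, ← Nat.card_eq_fintype_card]
          rw [Nat.even_iff] at hq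
          omega
        -- Here `-1` is already a square in `F`, so a constant serves modulo `f` itself.
        refine ⟨1, f, by simp, C r, ?_⟩
        rw [← C_pow, ← C_1, ← C_add, pow_two, ← hr]
        simp
    tfae_have 2 → 1 := by
      rintro ⟨g, f', rfl, h, hh⟩ l hl
      obtain ⟨k, rfl⟩ := hl.two_dvd
      have h0 := hf.ne_zero
      exact (existsSelfDualCode_two (pow_ne_zero_iff two_ne_zero |>.1 (left_ne_zero_of_mul h0))
        (right_ne_zero_of_mul h0) hh).mul k
    tfae_finish
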